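/- **Setting.** Let $z^*$ be a fixed infinite sequence of oracle cluster labels. For each $n$ the oracle partition $(V^{0,n}_1,\ldots,V^{0,n}_{K_{0,n}})$ consists of the nonempty sets among $\{i\in[n]: z^*_i=k\}$, and $K_{0,n}$ is their number; $s\sim t$ means $z^*_s=z^*_t$. For each $n$ let $f^{(n)}\ge 0$ be a symmetric leaf kernel and $r^{(n)}\ge 0$ a root kernel on a data space $\mathcal Y_n$, let $\lambda_n>0$ and $\delta_n>0$, and let $y^{(\infty)}=(y^{(n)})_n$ with $y^{(n)}=(y_1,\ldots,y_n)\in\mathcal Y_n^n$ be a data sequence (the $y^{(n)}$ for different $n$ are unrelated). Write $f^{(n)}_{st}=f^{(n)}(y_s, y_t)$ for the kernel values at $y^{(n)}$. **Posterior.** Under the Bayesian spanning forest model the integrated posterior of a labelled partition of $[n]$ into nonempty clusters is $$\Pi^*\big((V_1,\ldots,V_K)\mid y^{(n)}\big)=C_n\sum_{E,R}\lambda_n^{K}\prod_{k=1}^K\Big[r^{(n)}(y_{R_k})\prod_{(i,j)\in E_k}f^{(n)}_{ij}\Big] =C_n\prod_{k=1}^K\Big[\lambda_n\Big(\sum_{E_k}\prod_{(i,j)\in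 E_k}f^{(n)}_{ij}\Big)\Big(\sum_{i\in V_k}r^{(n)}(y_i)\Big)\Big],$$ where $E_k$ ranges over the spanning trees of $V_k$, $R_k$ over the points of $V_k$, and $C_n$ normalizes the sum over all $K$ and all labelled partitions to $1$. Two labelled partitions are equivalent if they agree up to relabelling of the clusters; $\Pi(\mathcal V_n\not\sim \mathcal W\mid y^{(n)})$ is the sum of $\Pi^*$ over all labelled partitions not equivalent to $\mathcal W$. **Assumption 1** (on $y^{(\infty)}$). There are constants $C_1,C_2>0$ with $C_1\delta_n\le\min_{i\in[n]} r^{(n)}(y_i)\le\max_{i\in[n]} r^{(n)}(y_i)\le C_2\delta_n$ for all sufficiently large $n$. **Assumption 2.** $K_{0,n}=o(\sqrt n)$. **Nice set.** Write $a_n\precsim b_n$ if for some constant $C>0$, $a_n\le Cb_n$ for all large $n$. Let $\mathcal D^{(\infty)}$ be the set of data sequences $y^{(\infty)}$ for which there are constants $\iota_1,\iota_2>0$ with $$\frac{\sup_{s\not\sim t;\,s,t\in[n]}f^{(n)}_{st}}{\delta_n\lambda_n}\precsim (K_{0,n}-1+\iota_1)^{-n},\qquad \frac{\delta_n\lambda_n}{\inf_{s'\sim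 t',\,s'\ne t';\,s',t'\in[n]}f^{(n)}_{s't'}}\precsim (K_{0,n}+1+\iota_2)^{-n},$$ where the supremum is $0$ if $K_{0,n}=1$, and the infimum is required to be positive for all large $n$. **Lemma.** Suppose Assumption 2 holds. Then for every data sequence $y^{(\infty)}\in\mathcal D^{(\infty)}$ satisfying Assumption 1, $$\Pi\big(\mathcal V_n\not\sim(V^{0,n}_1,\ldots,V^{0,n}_{K_{0,n}})\mid y^{(n)}\big)=o(1)\qquad(n\to\infty).$$ -/

import Mathlib

open Filter Topology Asymptotics

noncomputable section

namespace BSF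

/-- The specification of the Bayesian spanning forest model at one sample size: a symmetric
nonnegative leaf kernel `f`, a nonnegative root kernel `r`, and the prior parameter `lam > 0`
(the prior weight of a spanning forest with `K` trees is proportional to `lam ^ K`). -/
structure Model (Y : Type*) where
  f : Y → Y → ℝ
  f_symm : ∀ a b, f a b = f b a
  f_nonneg : ∀ a b, 0 ≤ f a b
  r : Y → ℝ
  r_nonneg : ∀ a, 0 ≤ r a
  lam : ℝ
  lam_pos : 0 < lam

/-- `(V k)` is a partition of `{0, …, n - 1}` into nonempty clusters. -/
def IsPartition {n : ℕ} {ι : Type*} (V : ι → Finset (Fin n)) : Prop :=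
  (∀ k, (V k).Nonempty) ∧ (∀ k l, k ≠ l → Disjoint (V k) (V l)) ∧ ∀ i, ∃ k, i ∈ V k

/-- Two partitions are equivalent if they agree up to a bijective relabelling of the clusters. -/
def PartEquiv {n : ℕ} {ι κ : Type*} (V : ι → Finset (Fin n)) (W : κ → Finset (Fin n)) : Prop :=
  ∃ ψ : ι ≃ κ, ∀ k, V k = W (ψ k)

/-- Labelled partitions `(V_1, …, V_K)` of the `n` data indices, for all possible `K`
(nonempty clusters force `K ≤ n`). -/
abbrev LabelledPartition (n : ℕ) : Type :=
  Σ K : Fin (n + 1), {V : Fin K → Finset (Fin n) // IsPartition V}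

/-- Spanning trees on the vertex set `S`. -/
abbrev SpanningTree {n : ℕ} (S : Finset (Fin n)) : Type :=
  {G : SimpleGraph {i // i ∈ S} // G.IsTree}

section Posterior

variable {Y : Type*} (M : Model Y) {n : ℕ} (y : Fin n → Y)

/-- The weight `f(y_i | y_j)` of an edge; by symmetry it does not depend on the direction that
the root induces on the edge. -/
def edgeWeight {S : Finset (Fin n)} (e : Sym2 {i // i ∈ S}) : ℝ :=
  Sym2.lift ⟨fun i j : {i // i ∈ S} => M.f (y i) (y j), fun i j => M.f_symm (y i) (y j)⟩ e

open scoped Classical in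
/-- The likelihood of the data given a partition `V`, a spanning tree `E k` and a root `R k` in
each cluster: `∏ k, r(y_{R k}) ∏_{(i,j) ∈ E k} f(y_i | y_j)`. -/
def likelihood {K : ℕ} (V : Fin K → Finset (Fin n))
    (E : ∀ k, SpanningTree (V k)) (R : ∀ k, {i // i ∈ V k}) : ℝ :=
  ∏ k, (M.r (y (R k)) * ∏ e ∈ (E k).1.edgeFinset, edgeWeight M y e)

open scoped Classical in
/-- Likelihood times prior, integrated over all spanning trees and all roots. -/
def integratedWeight {K : ℕ} (V : Fin K → Finset (Fin n)) : ℝ :=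
  ∑ E : (∀ k, SpanningTree (V k)), ∑ R : (∀ k, {i // i ∈ V k}),
    M.lam ^ K * likelihood M y V E R

open scoped Classical in
/-- Integrated posterior probability of a labelled partition. -/
def labelledPosterior (P : LabelledPartition n) : ℝ :=
  integratedWeight M y P.2.1 / ∑ Q : LabelledPartition n, integratedWeight M y Q.2.1

open scoped Classical in
/-- Posterior probability that the partition is not equivalent to the partition `W`. -/
def posteriorNotEquiv {κ : Type*} (W : κ → Finset (Fin n)) : ℝ :=
  ∑ P : LabelledPartition n with ¬ PartEquiv P.2.1 W, labelledPosterior M y P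

end Posterior

section Oracle

/-- Labels of the nonempty oracle clusters among the first `n` data. -/
def oracleLabels (z : ℕ → ℕ) (n : ℕ) : Finset ℕ := (Finset.range n).image z

/-- The number `K_{0,n}` of nonempty oracle clusters among the first `n` data. -/
def K0 (z : ℕ → ℕ) (n : ℕ) : ℕ := (oracleLabels z n).card

/-- The oracle partition of the first `n` data, indexed by the labels that occur. -/
def oraclePartition (z : ℕ → ℕ) (n : ℕ) (k : {k // k ∈ oracleLabels z n}) : Finset (Fin n) :=
  {i : Fin n | z i = k}

end Oracle

/-- `a_n ≾ b_n`. -/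
def Precsim (a b : ℕ → ℝ) : Prop := ∃ C : ℝ, 0 < C ∧ ∀ᶠ n in atTop, a n ≤ C * b n

section NiceSet

variable {Y : ℕ → Type*} (M : ∀ n, Model (Y n)) (z : ℕ → ℕ) (δ : ℕ → ℝ)

/-- Largest kernel value between data points of different oracle clusters
(equal to `0` if there is only one cluster). -/
def crossSup (y : ∀ n, Fin n → Y n) (n : ℕ) : ℝ :=
  sSup {x : ℝ | ∃ s t : Fin n, z s ≠ z t ∧ x = (M n).f (y n s) (y n t)}

/-- Smallest kernel value between two distinct data points of the same oracle cluster. -/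
def withinInf (y : ∀ n, Fin n → Y n) (n : ℕ) : ℝ :=
  sInf {x : ℝ | ∃ s t : Fin n, s ≠ t ∧ z s = z t ∧ x = (M n).f (y n s) (y n t)}

/-- The nice set. The conjunct `0 < withinInf` says that the second ratio is finite. -/
def niceSet : Set (∀ n, Fin n → Y n) :=
  {y | (∃ ι₁ : ℝ, 0 < ι₁ ∧
          Precsim (fun n => crossSup M z y n / (δ n * (M n).lam))
            (fun n => (((K0 z n : ℝ) - 1 + ι₁) ^ n)⁻¹)) ∧
       (∃ ι₂ : ℝ, 0 < ι₂ ∧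
          (∀ᶠ n in atTop, 0 < withinInf M z y n) ∧
          Precsim (fun n => δ n * (M n).lam / withinInf M z y n)
            (fun n => (((K0 z n : ℝ) + 1 + ι₂) ^ n)⁻¹))}

/-- The root kernel at the data is of exact order `δ n`. -/
def RootAssumption (y : ∀ n, Fin n → Y n) : Prop :=
  ∃ C₁ C₂ : ℝ, 0 < C₁ ∧ 0 < C₂ ∧ ∀ᶠ n in atTop, ∀ i : Fin n,
    C₁ * δ n ≤ (M n).r (y n i) ∧ (M n).r (y n i) ≤ C₂ * δ n

end NiceSet

/-- The number of oracle clusters is `o(√n)`. -/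
def OracleGrowth (z : ℕ → ℕ) : Prop :=
  (fun n => (K0 z n : ℝ)) =o[atTop] (fun n => Real.sqrt (n : ℝ))

end BSF

end

/-! The proof is a Peierls-type comparison of rooted spanning forests. Put `β = δ * lam`, let `ε`
bound the kernel across oracle clusters and `w > 0` bound it from below within them. Given a forest
`F` of any partition, delete its edges that cross oracle clusters (the set `C`) and complete the
rest inside the oracle clusters by new edges (the set `D`) to an oracle forest `F₀`. Then `F = (F₀ \
D) ∪ C`, and counting edges gives `K + |C| = K₀ + |D|` (`exists_forest_edgeFinset_eq`). Hence `F`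
costs a factor `ε / β` per edge of `C` and, up to a factor linear in `n`, `β / w` per edge of `D`,
relative to `F₀`.

The data `F₀, D, C, K` and the roots determine the labelled rooted forest, and `D = C = ∅` forces
the partition to be equivalent to the oracle. Summing over all `(D, C) ≠ (∅, ∅)` bounds the
non-oracle mass by the total weight of oracle forests times a small quantity
(`sum_integratedWeight_le`). The same total weight appears in a lower bound for the normalizing sum
(`le_integratedWeight`) and cancels, so no spanning trees need to be counted.

What remains is `(A n) ^ K₀` times a polynomial in `n` times a geometric sequence. Since `K₀ =
o(√n)`, the first factor is `exp (o(n))`, and the product tends to `0`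
(`tendsto_mul_pow_mul_pow_mul_pow`). -/

namespace BSF

/-! ### Spanning forests of partitions and their comparison with oracle forests. -/

section Forest

variable {n : ℕ} {ι : Type*}

/-- The union of spanning trees of the clusters, as a graph on all data indices. -/
def forest (V : ι → Finset (Fin n)) (E : ∀ k, SpanningTree (V k)) : SimpleGraph (Fin n) where
  Adj i j := ∃ k, ∃ hi : i ∈ V k, ∃ hj : j ∈ V k, (E k).1.Adj ⟨i, hi⟩ ⟨j, hj⟩
  symm := ⟨fun _ _ ⟨k, hi, hj, h⟩ => ⟨k, hj, hi, h.symm⟩⟩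
  loopless := ⟨fun _ ⟨_, _, _, h⟩ => h.ne rfl⟩

theorem IsPartition.eq_of_mem {V : ι → Finset (Fin n)} (hV : IsPartition V) {k l : ι} {i : Fin n}
    (hk : i ∈ V k) (hl : i ∈ V l) : k = l := by
  by_contra h
  exact Finset.disjoint_left.1 (hV.2.1 k l h) hk hl

theorem forest_adj_iff {V : ι → Finset (Fin n)} (hV : IsPartition V)
    (E : ∀ k, SpanningTree (V k)) (k : ι) (i j : {i // i ∈ V k}) :
    (forest V E).Adj i j ↔ (E k).1.Adj i j := by
  constructor
  · rintro ⟨l, hi, hj, h⟩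
    obtain rfl := hV.eq_of_mem hi i.2
    exact h
  · exact fun h => ⟨k, i.2, j.2, h⟩

theorem mem_of_reachable_forest {V : ι → Finset (Fin n)} (hV : IsPartition V)
    (E : ∀ k, SpanningTree (V k)) {k : ι} {i j : Fin n} (hi : i ∈ V k)
    (h : (forest V E).Reachable i j) : j ∈ V k := by
  obtain ⟨p⟩ := h
  induction p with
  | nil => exact hi
  | cons hadj _ ih =>
    obtain ⟨l, ha, hb, _⟩ := hadj
    obtain rfl := hV.eq_of_mem ha hi
    exact ih hb

theorem forest_reachable_iff {V : ι → Finset (Fin n)} (hV : IsPartition V)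
    (E : ∀ k, SpanningTree (V k)) {k : ι} {i j : Fin n} (hi : i ∈ V k) :
    (forest V E).Reachable i j ↔ j ∈ V k := by
  refine ⟨mem_of_reachable_forest hV E hi, fun hj => ?_⟩
  let φ : (E k).1 →g forest V E := ⟨Subtype.val, fun {a b} h => ⟨k, a.2, b.2, h⟩⟩
  exact ((E k).2.1.preconnected ⟨i, hi⟩ ⟨j, hj⟩).map φ

/-- A cycle stays in one connected component, hence in one cluster, where the induced graph is a
copy of the tree of that cluster. -/
theorem forest_isAcyclic {V : ι → Finset (Fin n)} (hV : IsPartition V)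
    (E : ∀ k, SpanningTree (V k)) : (forest V E).IsAcyclic := by
  intro v c hc
  obtain ⟨k, hk⟩ := hV.2.2 v
  have hs : ∀ x ∈ c.support, x ∈ (↑(V k) : Set (Fin n)) := fun x hx =>
    mem_of_reachable_forest hV E hk ⟨c.takeUntil x hx⟩
  have hac : ((forest V E).induce (↑(V k) : Set (Fin n))).IsAcyclic := by
    refine SimpleGraph.IsAcyclic.comap (G' := (E k).1)
      ⟨fun x => ⟨x.1, x.2⟩, fun {a b} h => ?_⟩ ?_ (E k).2.2
    · exact (forest_adj_iff hV E k ⟨a.1, a.2⟩ ⟨b.1, b.2⟩).1 h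
    · intro a b h
      exact Subtype.ext (congrArg (fun x : {i // i ∈ V k} => x.1) h)
  refine hac (c.induce _ hs) ?_
  rw [← SimpleGraph.Walk.isCycle_map_iff_of_injective
    (f := (SimpleGraph.Embedding.induce (G := forest V E) (↑(V k) : Set (Fin n))).toHom)
    Subtype.val_injective]
  exact (c.map_induce hs).symm ▸ hc

/-- An acyclic graph whose connected components are the clusters restricts to a spanning tree of
each cluster, and is the union of these trees. -/
theorem exists_forest_eq {V : ι → Finset (Fin n)} (hV : IsPartition V) (G : SimpleGraph (Fin n))
    (hG : G.IsAcyclic) (hr : ∀ k, ∀ i ∈ V k, ∀ j, G.Reachable i j ↔ j ∈ V k) :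
    ∃ E : ∀ k, SpanningTree (V k), forest V E = G := by
  have hT : ∀ k, (G.comap (Subtype.val : {i // i ∈ V k} → Fin n)).IsTree := by
    intro k
    have : Nonempty {i // i ∈ V k} := (hV.1 k).to_subtype
    refine ⟨⟨?_⟩, hG.of_comap ⟨_, Subtype.val_injective⟩⟩
    rintro ⟨i, hi⟩ ⟨j, hj⟩
    obtain ⟨p⟩ := (hr k i hi j).2 hj
    exact ⟨p.induce (↑(V k) : Set (Fin n)) fun x hx => (hr k i hi x).1 ⟨p.takeUntil x hx⟩⟩
  refine ⟨fun k => ⟨_, hT k⟩, ?_⟩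
  ext i j
  constructor
  · rintro ⟨k, hi, hj, h⟩
    exact h
  · intro h
    obtain ⟨k, hi⟩ := hV.2.2 i
    exact ⟨k, hi, (hr k i hi j).1 h.reachable, h⟩

open scoped Classical in
theorem forest_edgeFinset [Fintype ι] (V : ι → Finset (Fin n)) (E : ∀ k, SpanningTree (V k)) :
    (forest V E).edgeFinset = Finset.univ.biUnion fun k =>
      (E k).1.edgeFinset.image (Sym2.map Subtype.val) := by
  ext e
  induction e with
  | h i j =>
    simp only [SimpleGraph.mem_edgeFinset, SimpleGraph.mem_edgeSet, Finset.mem_biUnion,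
      Finset.mem_univ, true_and, Finset.mem_image]
    constructor
    · rintro ⟨k, hi, hj, h⟩
      exact ⟨k, s(⟨i, hi⟩, ⟨j, hj⟩), h, rfl⟩
    · rintro ⟨k, e, he, h⟩
      induction e with
      | h a b =>
        have : (forest V E).Adj a b := ⟨k, a.2, b.2, he⟩
        rw [← SimpleGraph.mem_edgeSet] at this ⊢
        rwa [← h]

open scoped Classical in
theorem pairwiseDisjoint_edges [Fintype ι] {V : ι → Finset (Fin n)} (hV : IsPartition V)
    (E : ∀ k, SpanningTree (V k)) : (↑(Finset.univ : Finset ι) : Set ι).PairwiseDisjoint fun k =>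
      (E k).1.edgeFinset.image (Sym2.map (Subtype.val : {i // i ∈ V k} → Fin n)) := by
  intro k _ l _ hkl
  refine Finset.disjoint_left.2 fun e hk hl => hkl ?_
  simp only [Finset.mem_image] at hk hl
  obtain ⟨a, -, rfl⟩ := hk
  obtain ⟨b, -, hb⟩ := hl
  induction a with
  | h a a' =>
    have ha : (a : Fin n) ∈ Sym2.map (Subtype.val : {i // i ∈ V l} → Fin n) b := by
      rw [hb]; simp
    obtain ⟨c, -, hc⟩ := Sym2.mem_map.1 ha
    exact hV.eq_of_mem a.2 (hc ▸ c.2)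

open scoped Classical in
theorem prod_forest_edgeFinset [Fintype ι] {α : Type*} [CommMonoid α] {V : ι → Finset (Fin n)}
    (hV : IsPartition V) (E : ∀ k, SpanningTree (V k)) (g : Sym2 (Fin n) → α) :
    ∏ e ∈ (forest V E).edgeFinset, g e =
      ∏ k, ∏ e ∈ (E k).1.edgeFinset, g (Sym2.map Subtype.val e) := by
  rw [forest_edgeFinset, Finset.prod_biUnion (pairwiseDisjoint_edges hV E)]
  refine Finset.prod_congr rfl fun k _ => ?_
  exact Finset.prod_image fun a _ b _ h => Sym2.map.injective Subtype.val_injective h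

-- A tree on `V k` has `|V k| - 1` edges. Applied to two partitions, this count links the change in
-- the number of clusters to the number of exchanged edges.
open scoped Classical in
theorem card_forest_edgeFinset [Fintype ι] {V : ι → Finset (Fin n)} (hV : IsPartition V)
    (E : ∀ k, SpanningTree (V k)) :
    (forest V E).edgeFinset.card + Fintype.card ι = n := by
  have h1 : (forest V E).edgeFinset.card = ∑ k, (E k).1.edgeFinset.card := by
    rw [forest_edgeFinset, Finset.card_biUnion (pairwiseDisjoint_edges hV E)]
    exact Finset.sum_congr rfl fun k _ =>
      Finset.card_image_of_injective _ (Sym2.map.injective Subtype.val_injective)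
  have h2 : ∑ k, (V k).card = n := by
    rw [← Finset.card_biUnion (fun k _ l _ h => hV.2.1 k l h)]
    have : Finset.univ.biUnion V = Finset.univ := by
      ext i
      simpa using hV.2.2 i
    rw [this, Finset.card_univ, Fintype.card_fin]
  rw [h1]
  refine Eq.trans ?_ h2
  rw [← Finset.card_univ, Finset.card_eq_sum_ones, ← Finset.sum_add_distrib]
  refine Finset.sum_congr rfl fun k _ => ?_
  have := (E k).2.card_edgeFinset
  simpa using this

open scoped Classical in
/-- Removing the edges of a spanning forest of `V` that cross the clusters of `W` and completing
the rest to a spanning forest of `W` changes the edge set by a set `D` of edges within clusters of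
`W` and a set `C` of edges between clusters of `W`. -/
theorem exists_forest_edgeFinset_eq {κ : Type*} [Fintype ι] [Fintype κ] {V : ι → Finset (Fin n)}
    (hV : IsPartition V) {W : κ → Finset (Fin n)} (hW : IsPartition W)
    (E : ∀ k, SpanningTree (V k)) :
    ∃ (E₀ : ∀ l, SpanningTree (W l)) (D C : Finset (Sym2 (Fin n))),
      (forest V E).edgeFinset = ((forest W E₀).edgeFinset \ D) ∪ C ∧
      D ⊆ (forest W E₀).edgeFinset ∧
      Disjoint ((forest W E₀).edgeFinset \ D) C ∧
      (∀ i j, s(i, j) ∈ C → ¬ ∃ l, i ∈ W l ∧ j ∈ W l) ∧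
      Fintype.card ι + C.card = Fintype.card κ + D.card := by
  -- `H` is the disjoint union of the complete graphs on the clusters of `W`; its components are
  -- these clusters.
  let H : SimpleGraph (Fin n) :=
    { Adj := fun i j => i ≠ j ∧ ∃ l, i ∈ W l ∧ j ∈ W l
      symm := ⟨fun i j ⟨h, l, hi, hj⟩ => ⟨h.symm, l, hj, hi⟩⟩
      loopless := ⟨fun i h => h.1 rfl⟩ }
  have hH : ∀ l, ∀ i ∈ W l, ∀ j, H.Reachable i j ↔ j ∈ W l := by
    intro l i hi j
    constructor
    · rintro ⟨p⟩
      induction p with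
      | nil => exact hi
      | cons hadj _ ih =>
        obtain ⟨_, l', ha, hb⟩ := hadj
        obtain rfl := hW.eq_of_mem ha hi
        exact ih hb
    · intro hj
      by_cases hij : i = j
      · subst hij; rfl
      · exact SimpleGraph.Adj.reachable ⟨hij, l, hi, hj⟩
  -- The part of the forest inside the clusters of `W` is acyclic, so it extends within `H` to an
  -- acyclic `G` with the components of `H`, that is, to a spanning forest of `W`.
  obtain ⟨G, hFG, hGH, hG, hGr⟩ := H.exists_isAcyclic_reachable_eq_le_of_le_of_isAcyclic
    (inf_le_right : forest V E ⊓ H ≤ H) ((forest_isAcyclic hV E).anti inf_le_left)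
  obtain ⟨E₀, rfl⟩ := exists_forest_eq hW G hG (by rw [hGr]; exact hH)
  have hmem : ∀ i j, s(i, j) ∈ (forest W E₀).edgeFinset → ∃ l, i ∈ W l ∧ j ∈ W l := by
    intro i j h
    rw [SimpleGraph.mem_edgeFinset, SimpleGraph.mem_edgeSet] at h
    exact (hGH h).2
  have hD : (forest W E₀).edgeFinset \ ((forest W E₀).edgeFinset \ (forest V E).edgeFinset) =
      (forest W E₀).edgeFinset ∩ (forest V E).edgeFinset := by
    ext e; simp
  have hC : ∀ i j, s(i, j) ∈ (forest V E).edgeFinset \ (forest W E₀).edgeFinset →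
      ¬ ∃ l, i ∈ W l ∧ j ∈ W l := by
    intro i j h hl
    simp only [Finset.mem_sdiff, SimpleGraph.mem_edgeFinset, SimpleGraph.mem_edgeSet] at h
    -- An edge of `forest V E` inside a cluster of `W` was kept in the completion, so it cannot be
    -- in the difference.
    exact h.2 (hFG ⟨h.1, h.1.ne, hl⟩)
  have hdisj : Disjoint ((forest W E₀).edgeFinset ∩ (forest V E).edgeFinset)
      ((forest V E).edgeFinset \ (forest W E₀).edgeFinset) :=
    Finset.disjoint_left.2 fun e h h' => (Finset.mem_sdiff.1 h').2 (Finset.mem_inter.1 h).1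
  refine ⟨E₀, (forest W E₀).edgeFinset \ (forest V E).edgeFinset,
    (forest V E).edgeFinset \ (forest W E₀).edgeFinset, ?_, Finset.sdiff_subset, ?_, hC, ?_⟩
  · rw [hD]; ext e; simp only [Finset.mem_union, Finset.mem_inter, Finset.mem_sdiff]; tauto
  · rwa [hD]
  · have h1 := card_forest_edgeFinset hV E
    have h2 := card_forest_edgeFinset hW E₀
    have h3 := Finset.card_sdiff_add_card_inter (forest V E).edgeFinset (forest W E₀).edgeFinset
    have h4 := Finset.card_sdiff_add_card_inter (forest W E₀).edgeFinset (forest V E).edgeFinset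
    rw [Finset.inter_comm] at h4
    omega

/-- A partition is determined, up to relabelling, by any spanning forest. -/
theorem partEquiv_of_forest_eq {κ : Type*} {V : ι → Finset (Fin n)}
    (hV : IsPartition V) {W : κ → Finset (Fin n)} (hW : IsPartition W)
    (E : ∀ k, SpanningTree (V k)) (E₀ : ∀ l, SpanningTree (W l))
    (h : forest V E = forest W E₀) : PartEquiv V W := by
  have key : ∀ k, ∃ l, V k = W l := by
    intro k
    obtain ⟨i, hi⟩ := hV.1 k
    obtain ⟨l, hl⟩ := hW.2.2 i
    refine ⟨l, ?_⟩
    ext j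
    rw [← forest_reachable_iff hV E hi, ← forest_reachable_iff hW E₀ hl, h]
  choose ψ hψ using key
  refine ⟨Equiv.ofBijective ψ ⟨fun k k' hk => ?_, fun l => ?_⟩, hψ⟩
  · obtain ⟨i, hi⟩ := hV.1 k
    exact hV.eq_of_mem hi (by rwa [hψ k', ← hk, ← hψ k])
  · obtain ⟨i, hi⟩ := hW.1 l
    obtain ⟨k, hk⟩ := hV.2.2 i
    exact ⟨k, hW.eq_of_mem (by rwa [← hψ k]) hi⟩

/-- The graph of a rooted spanning forest and its roots determine the clusters and the trees. -/
theorem eq_of_forest_eq {V V' : ι → Finset (Fin n)} (hV : IsPartition V) (hV' : IsPartition V')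
    (E : ∀ k, SpanningTree (V k)) (E' : ∀ k, SpanningTree (V' k))
    (R : ∀ k, {i // i ∈ V k}) (R' : ∀ k, {i // i ∈ V' k})
    (h : forest V E = forest V' E') (hR : ∀ k, (R k : Fin n) = R' k) :
    V = V' ∧ E ≍ E' ∧ R ≍ R' := by
  have hVV : V = V' := by
    funext k
    ext j
    rw [← forest_reachable_iff hV E (R k).2, ← forest_reachable_iff hV' E' (R' k).2, h, hR]
  subst hVV
  refine ⟨rfl, heq_of_eq ?_, heq_of_eq ?_⟩
  · funext k
    refine Subtype.ext ?_
    ext i j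
    rw [← forest_adj_iff hV E, ← forest_adj_iff hV E', h]
  · exact funext fun k => Subtype.ext (hR k)

end Forest

/-! ### The bound on the posterior at a fixed sample size. -/

section Bound

variable {Y : Type*} (M : Model Y) {n : ℕ} (y : Fin n → Y)

/-- The kernel value at an unordered pair of data indices. -/
def kernelWeight : Sym2 (Fin n) → ℝ :=
  Sym2.lift ⟨fun i j => M.f (y i) (y j), fun i j => M.f_symm (y i) (y j)⟩

theorem kernelWeight_nonneg (e : Sym2 (Fin n)) : 0 ≤ kernelWeight M y e := by
  induction e with
  | h i j => exact M.f_nonneg _ _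

open scoped Classical in
/-- The product of the kernel values over the edges of a spanning forest. -/
noncomputable def forestWeight {ι : Type*} (V : ι → Finset (Fin n))
    (E : ∀ k, SpanningTree (V k)) : ℝ :=
  ∏ e ∈ (forest V E).edgeFinset, kernelWeight M y e

theorem forestWeight_nonneg {ι : Type*} (V : ι → Finset (Fin n)) (E : ∀ k, SpanningTree (V k)) :
    0 ≤ forestWeight M y V E :=
  Finset.prod_nonneg fun _ _ => kernelWeight_nonneg M y _

theorem likelihood_eq {K : ℕ} {V : Fin K → Finset (Fin n)} (hV : IsPartition V)
    (E : ∀ k, SpanningTree (V k)) (R : ∀ k, {i // i ∈ V k}) :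
    likelihood M y V E R = (∏ k, M.r (y (R k))) * forestWeight M y V E := by
  rw [likelihood, Finset.prod_mul_distrib, forestWeight, prod_forest_edgeFinset hV]
  congr 1
  refine Finset.prod_congr rfl fun k _ => Finset.prod_congr rfl fun e _ => ?_
  induction e with
  | h i j => rfl

theorem integratedWeight_nonneg {K : ℕ} (V : Fin K → Finset (Fin n)) :
    0 ≤ integratedWeight M y V := by
  refine Finset.sum_nonneg fun E _ => Finset.sum_nonneg fun R _ =>
    mul_nonneg (pow_nonneg M.lam_pos.le _) (Finset.prod_nonneg fun k _ =>
      mul_nonneg (M.r_nonneg _) (Finset.prod_nonneg fun e _ => ?_))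
  induction e with
  | h i j => exact M.f_nonneg _ _

-- Both forests share the factors over `F₀ \ D`. The remaining ones are at most `ε` on `C` and at
-- least `w` on `D`; the product form avoids dividing by kernel values.
open scoped Classical in
theorem forestWeight_mul_le {ι κ : Type*} {V : ι → Finset (Fin n)} {W : κ → Finset (Fin n)}
    (E : ∀ k, SpanningTree (V k)) (E₀ : ∀ l, SpanningTree (W l)) {D C : Finset (Sym2 (Fin n))}
    (hF : (forest V E).edgeFinset = ((forest W E₀).edgeFinset \ D) ∪ C)
    (hD : D ⊆ (forest W E₀).edgeFinset)
    (hdisj : Disjoint ((forest W E₀).edgeFinset \ D) C)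
    (hC : ∀ i j, s(i, j) ∈ C → ¬ ∃ l, i ∈ W l ∧ j ∈ W l)
    {ε w : ℝ} (hw : 0 ≤ w)
    (hcross : ∀ i j, (¬ ∃ l, i ∈ W l ∧ j ∈ W l) → M.f (y i) (y j) ≤ ε)
    (hwithin : ∀ i j, i ≠ j → (∃ l, i ∈ W l ∧ j ∈ W l) → w ≤ M.f (y i) (y j)) :
    forestWeight M y V E * w ^ D.card ≤ ε ^ C.card * forestWeight M y W E₀ := by
  have h0 : ∀ s : Finset (Sym2 (Fin n)), 0 ≤ ∏ e ∈ s, kernelWeight M y e := fun s =>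
    Finset.prod_nonneg fun _ _ => kernelWeight_nonneg M y _
  have hCle : ∏ e ∈ C, kernelWeight M y e ≤ ε ^ C.card := by
    rw [← Finset.prod_const]
    refine Finset.prod_le_prod (fun _ _ => kernelWeight_nonneg M y _) fun e he => ?_
    induction e with
    | h i j => exact hcross i j (hC i j he)
  have hDle : w ^ D.card ≤ ∏ e ∈ D, kernelWeight M y e := by
    rw [← Finset.prod_const]
    refine Finset.prod_le_prod (fun _ _ => hw) fun e he => ?_
    induction e with
    | h i j =>
      have hadj := hD he
      rw [SimpleGraph.mem_edgeFinset, SimpleGraph.mem_edgeSet] at hadj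
      obtain ⟨l, hi, hj, -⟩ := id hadj
      exact hwithin i j hadj.ne ⟨l, hi, hj⟩
  unfold forestWeight
  rw [hF, Finset.prod_union hdisj, ← Finset.prod_sdiff hD, mul_comm (∏ e ∈ _, _) (∏ e ∈ C, _),
    mul_assoc]
  exact mul_le_mul hCle (mul_le_mul_of_nonneg_left hDle (h0 _))
    (mul_nonneg (h0 _) (pow_nonneg hw _)) ((h0 C).trans hCle)

/-- Binomial expansion of both powers. The omitted pair contributes the `1` that is subtracted,
which makes the sum small for small `a` and `b`. -/
theorem sum_pow_card_mul_pow_card {α : Type*} [Fintype α] [DecidableEq α] (a b : ℝ) :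
    ∑ p ∈ (Finset.univ : Finset (Finset α × Finset α)).erase (∅, ∅),
      a ^ p.1.card * b ^ p.2.card =
      (1 + a) ^ Fintype.card α * (1 + b) ^ Fintype.card α - 1 := by
  have h : ∀ c : ℝ, ∑ s : Finset α, c ^ s.card = (1 + c) ^ Fintype.card α := by
    intro c
    have := Finset.prod_one_add (f := fun _ : α => c) Finset.univ
    simpa using this.symm
  rw [← h, ← h, Finset.sum_mul_sum, ← Finset.sum_product', Finset.univ_product_univ,
    ← Finset.add_sum_erase _ _ (Finset.mem_univ ((∅, ∅) : Finset α × Finset α))]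
  simp

theorem sum_le_sum_of_injOn {α β : Type*} {s : Finset α} {t : Finset β}
    {f : α → ℝ} {g : β → ℝ} (φ : α → β) (hφ : Set.InjOn φ s) (hst : ∀ a ∈ s, φ a ∈ t)
    (hfg : ∀ a ∈ s, f a ≤ g (φ a)) (hg : ∀ b ∈ t, 0 ≤ g b) :
    ∑ a ∈ s, f a ≤ ∑ b ∈ t, g b := by
  classical
  calc ∑ a ∈ s, f a ≤ ∑ a ∈ s, g (φ a) := Finset.sum_le_sum hfg
    _ = ∑ b ∈ s.image φ, g b := (Finset.sum_image hφ).symm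
    _ ≤ ∑ b ∈ t, g b := Finset.sum_le_sum_of_subset_of_nonneg
        (Finset.image_subset_iff.2 hst) fun b hb _ => hg b hb

/-- A labelled partition with a spanning tree and a root in each cluster. -/
abbrev RootedForest (n : ℕ) : Type :=
  Σ P : LabelledPartition n, Σ _ : (∀ k, SpanningTree (P.2.1 k)), ∀ k, {i // i ∈ P.2.1 k}

theorem RootedForest.ext_of_forest_eq {A B : RootedForest n} (hK : A.1.1 = B.1.1)
    (hF : forest A.1.2.1 A.2.1 = forest B.1.2.1 B.2.1)
    (hR : (fun k => (A.2.2 k : Fin n)) ≍ (fun k => (B.2.2 k : Fin n))) : A = B := by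
  obtain ⟨⟨K, V, hV⟩, E, R⟩ := A
  obtain ⟨⟨K', V', hV'⟩, E', R'⟩ := B
  obtain rfl : K = K' := hK
  obtain ⟨rfl, hE, hRR⟩ := eq_of_forest_eq hV hV' E E' R R' hF
    (fun k => congrFun (eq_of_heq hR) k)
  obtain rfl := eq_of_heq hE
  obtain rfl := eq_of_heq hRR
  rfl

-- Each non-oracle rooted forest is charged, injectively, to an oracle forest, a nontrivial exchange
-- `(D, C)`, and a number of clusters with its roots. Summing the charges gives the product on the
-- right; the factor `n + 1` counts the values of `K`.
open scoped Classical in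
theorem sum_integratedWeight_le {K₀ : ℕ} {W : Fin K₀ → Finset (Fin n)} (hW : IsPartition W)
    {δ C₂ ε w : ℝ} (hn : 1 ≤ n) (hδ : 0 < δ) (hC₂ : 1 ≤ C₂) (hε : 0 ≤ ε) (hw : 0 < w)
    (hr : ∀ i, M.r (y i) ≤ C₂ * δ)
    (hcross : ∀ i j, (¬ ∃ l, i ∈ W l ∧ j ∈ W l) → M.f (y i) (y j) ≤ ε)
    (hwithin : ∀ i j, i ≠ j → (∃ l, i ∈ W l ∧ j ∈ W l) → w ≤ M.f (y i) (y j)) :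
    ∑ P : LabelledPartition n with ¬ PartEquiv P.2.1 W, integratedWeight M y P.2.1 ≤
      (∑ E₀ : ∀ l, SpanningTree (W l), forestWeight M y W E₀) *
        ((C₂ * n * (δ * M.lam)) ^ K₀ *
          (((1 + C₂ * n * (δ * M.lam / w)) ^ Fintype.card (Sym2 (Fin n)) * (1 + ε / (δ * M.lam)) ^ Fintype.card (Sym2 (Fin n)) - 1) * (n + 1))) := by
  have hlam := M.lam_pos
  have hn0 : (0 : ℝ) < n := by exact_mod_cast hn
  have hn1 : (1 : ℝ) ≤ n := by exact_mod_cast hn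
  let c : RootedForest n → ℝ := fun A => M.lam ^ (A.1.1 : ℕ) * likelihood M y A.1.2.1 A.2.1 A.2.2
  have hsum : ∑ P : LabelledPartition n with ¬ PartEquiv P.2.1 W, integratedWeight M y P.2.1 =
      ∑ A ∈ (Finset.univ.filter fun P : LabelledPartition n => ¬ PartEquiv P.2.1 W).sigma
        (fun _ => Finset.univ), c A := by
    rw [Finset.sum_sigma]
    refine Finset.sum_congr rfl fun P _ => ?_
    rw [Fintype.sum_sigma]
    rfl
  choose E₀ D C hF hD hdisj hC hcard using fun A : RootedForest n =>
    exists_forest_edgeFinset_eq A.1.2.2 hW A.2.1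
  let φ : RootedForest n → (∀ l, SpanningTree (W l)) ×
      ((Finset (Sym2 (Fin n)) × Finset (Sym2 (Fin n))) × Σ K : Fin (n + 1), (Fin K → Fin n)) :=
    fun A => (E₀ A, (D A, C A), ⟨A.1.1, fun k => (A.2.2 k : Fin n)⟩)
  -- The factor `n ^ (-K)` compensates for the `n ^ K` maps `Fin K → Fin n` that can record the
  -- roots; the compensating `n ^ K` is absorbed into the powers of `C₂ * n`.
  let g : (∀ l, SpanningTree (W l)) ×
      ((Finset (Sym2 (Fin n)) × Finset (Sym2 (Fin n))) × Σ K : Fin (n + 1), (Fin K → Fin n)) → ℝ :=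
    fun q => forestWeight M y W q.1 * ((C₂ * n * (δ * M.lam)) ^ K₀ *
      (((C₂ * n * (δ * M.lam / w)) ^ q.2.1.1.card * (ε / (δ * M.lam)) ^ q.2.1.2.card) *
        ((n : ℝ) ^ (q.2.2.1 : ℕ))⁻¹))
  rw [hsum]
  refine (sum_le_sum_of_injOn (t := Finset.univ ×ˢ (Finset.univ.erase (∅, ∅) ×ˢ Finset.univ))
    (g := g) φ ?_ ?_ ?_ ?_).trans (le_of_eq ?_)
  · intro A _ B _ hAB
    simp only [φ, Prod.mk.injEq, Sigma.mk.injEq] at hAB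
    obtain ⟨h1, ⟨h2, h3⟩, h4, h5⟩ := hAB
    refine RootedForest.ext_of_forest_eq h4 ?_ h5
    rw [← SimpleGraph.edgeFinset_inj, hF A, hF B, h1, h2, h3]
  · intro A hA
    simp only [φ, Finset.mem_product, Finset.mem_univ, true_and, and_true, Finset.mem_erase, ne_eq,
      Prod.mk.injEq]
    rintro ⟨h1, h2⟩
    simp only [Finset.mem_sigma, Finset.mem_filter, Finset.mem_univ, true_and, and_true] at hA
    -- If nothing is exchanged, the forest is an oracle forest and its partition is equivalent to
    -- `W`.
    refine hA (partEquiv_of_forest_eq A.1.2.2 hW A.2.1 (E₀ A) ?_)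
    rw [← SimpleGraph.edgeFinset_inj, hF A, h1, h2]
    simp
  · intro A _
    have hwt := forestWeight_mul_le M y A.2.1 (E₀ A) (hF A) (hD A) (hdisj A) (hC A) hw.le
      hcross hwithin
    have hK := hcard A
    rw [Fintype.card_fin, Fintype.card_fin] at hK
    have hrR : ∏ k, M.r (y (A.2.2 k)) ≤ (C₂ * δ) ^ (A.1.1 : ℕ) := by
      have := Finset.prod_le_prod (s := Finset.univ) (f := fun k => M.r (y (A.2.2 k)))
        (g := fun _ => C₂ * δ) (fun k _ => M.r_nonneg _) (fun k _ => hr _)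
      simpa using this
    have hC₂0 : 0 < C₂ := one_pos.trans_le hC₂
    have hβ : 0 < δ * M.lam := mul_pos hδ hlam
    have hW0 := forestWeight_nonneg M y W (E₀ A)
    have hwt' : forestWeight M y A.1.2.1 A.2.1 ≤
        ε ^ (C A).card * forestWeight M y W (E₀ A) / w ^ (D A).card :=
      (le_div_iff₀ (pow_pos hw _)).2 hwt
    -- The edge count gives `K ≤ K₀ + |D|`; monotonicity in the exponent is where `1 ≤ C₂` and `1 ≤
    -- n` enter.
    have hpow : (C₂ * n) ^ (A.1.1 : ℕ) ≤ (C₂ * n) ^ (K₀ + (D A).card) :=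
      pow_le_pow_right₀ (one_le_mul_of_one_le_of_one_le hC₂ hn1) (by omega)
    -- `β` may lie on either side of `1`, so here the exact identity `K + |C| = K₀ + |D|` is needed.
    have hβpow : (δ * M.lam) ^ (A.1.1 : ℕ) =
        (δ * M.lam) ^ (K₀ + (D A).card) / (δ * M.lam) ^ (C A).card := by
      rw [eq_div_iff (pow_pos hβ _).ne', ← pow_add, hK]
    calc c A = M.lam ^ (A.1.1 : ℕ) * ((∏ k, M.r (y (A.2.2 k))) *
          forestWeight M y A.1.2.1 A.2.1) := by
          rw [← likelihood_eq M y A.1.2.2]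
      _ ≤ M.lam ^ (A.1.1 : ℕ) * ((C₂ * δ) ^ (A.1.1 : ℕ) *
          (ε ^ (C A).card * forestWeight M y W (E₀ A) / w ^ (D A).card)) := by
          refine mul_le_mul_of_nonneg_left (mul_le_mul hrR hwt' (forestWeight_nonneg M y _ _)
            (by positivity)) (by positivity)
      _ = (C₂ * n) ^ (A.1.1 : ℕ) * ((δ * M.lam) ^ (A.1.1 : ℕ) * ((n : ℝ) ^ (A.1.1 : ℕ))⁻¹ *
          (ε ^ (C A).card * forestWeight M y W (E₀ A) / w ^ (D A).card)) := by
          simp only [mul_pow]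
          field_simp
      _ ≤ (C₂ * n) ^ (K₀ + (D A).card) * ((δ * M.lam) ^ (A.1.1 : ℕ) *
          ((n : ℝ) ^ (A.1.1 : ℕ))⁻¹ *
          (ε ^ (C A).card * forestWeight M y W (E₀ A) / w ^ (D A).card)) :=
          mul_le_mul_of_nonneg_right hpow (by positivity)
      _ = g (φ A) := by
          rw [hβpow]
          simp only [g, φ, div_pow, mul_pow, pow_add]
          field_simp
  · intro q _
    have hW0 := forestWeight_nonneg M y W q.1
    have hC₂0 : 0 < C₂ := one_pos.trans_le hC₂
    exact mul_nonneg hW0 (by positivity)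
  · simp only [g]
    rw [Finset.sum_product, Finset.sum_mul]
    refine Finset.sum_congr rfl fun E₀ _ => ?_
    dsimp only
    rw [← Finset.mul_sum, ← Finset.mul_sum, ← sum_pow_card_mul_pow_card, Finset.sum_product,
      Finset.sum_mul]
    congr 2
    refine Finset.sum_congr rfl fun p _ => ?_
    dsimp only
    rw [← Finset.mul_sum, Fintype.sum_sigma]
    congr 1
    have : ∀ K : Fin (n + 1), ∑ _ : (Fin K → Fin n), ((n : ℝ) ^ (K : ℕ))⁻¹ = 1 := by
      intro K
      rw [Finset.sum_const, Finset.card_univ, Fintype.card_fun, Fintype.card_fin, Fintype.card_fin,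
        nsmul_eq_mul, Nat.cast_pow, mul_inv_cancel₀ (pow_pos hn0 _).ne']
    simp only [this]
    simp

open scoped Classical in
theorem le_integratedWeight {K₀ : ℕ} {W : Fin K₀ → Finset (Fin n)} (hW : IsPartition W)
    {δ C₁ : ℝ} (hδ : 0 < δ) (hC₁ : 0 < C₁) (hr : ∀ i, C₁ * δ ≤ M.r (y i)) :
    (C₁ * (δ * M.lam)) ^ K₀ * ∑ E₀ : ∀ l, SpanningTree (W l), forestWeight M y W E₀ ≤
      integratedWeight M y W := by
  have hlam := M.lam_pos
  rw [integratedWeight, Finset.mul_sum]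
  refine Finset.sum_le_sum fun E _ => ?_
  have hterm : ∀ R : (∀ k, {i // i ∈ W k}), (C₁ * (δ * M.lam)) ^ K₀ * forestWeight M y W E ≤
      M.lam ^ K₀ * likelihood M y W E R := by
    intro R
    rw [likelihood_eq M y hW, ← mul_assoc (M.lam ^ K₀)]
    refine mul_le_mul_of_nonneg_right ?_ (forestWeight_nonneg M y W E)
    have := Finset.prod_le_prod (s := Finset.univ) (f := fun _ : Fin K₀ => C₁ * δ)
      (g := fun k => M.r (y (R k))) (fun k _ => by positivity) (fun k _ => hr _)
    rw [Finset.prod_const, Finset.card_univ, Fintype.card_fin] at this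
    calc (C₁ * (δ * M.lam)) ^ K₀ = M.lam ^ K₀ * (C₁ * δ) ^ K₀ := by rw [← mul_pow]; ring
      _ ≤ _ := mul_le_mul_of_nonneg_left this (by positivity)
  -- One choice of roots suffices for the lower bound.
  let R₀ : ∀ k, {i // i ∈ W k} := fun k => ⟨_, (hW.1 k).choose_spec⟩
  have h0 : 0 ≤ (C₁ * (δ * M.lam)) ^ K₀ * forestWeight M y W E :=
    mul_nonneg (by positivity) (forestWeight_nonneg M y W E)
  exact (hterm R₀).trans (Finset.single_le_sum (f := fun R => M.lam ^ K₀ * likelihood M y W E R)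
    (fun R _ => h0.trans (hterm R)) (Finset.mem_univ R₀))

theorem posteriorNotEquiv_nonneg {κ : Type*} (W : κ → Finset (Fin n)) :
    0 ≤ posteriorNotEquiv M y W :=
  Finset.sum_nonneg fun _ _ => div_nonneg (integratedWeight_nonneg M y _)
    (Finset.sum_nonneg fun _ _ => integratedWeight_nonneg M y _)

/-- Allows the oracle partition, indexed by the labels that occur, to be reindexed by `Fin (K0 z
n)`. -/
theorem posteriorNotEquiv_comp_equiv {κ κ' : Type*} (W : κ → Finset (Fin n)) (e : κ' ≃ κ) :
    posteriorNotEquiv M y (W ∘ e) = posteriorNotEquiv M y W := by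
  unfold posteriorNotEquiv
  congr 1
  ext P
  simp only [Finset.mem_filter, Finset.mem_univ, true_and, not_iff_not]
  constructor
  · rintro ⟨ψ, h⟩
    exact ⟨ψ.trans e, h⟩
  · rintro ⟨ψ, h⟩
    exact ⟨ψ.trans e.symm, fun k => by simpa using h k⟩

/-- The normalizing sum is bounded below by the single labelled partition `W`. The sum over oracle
forests and the power `β ^ K₀` then cancel, leaving `(C₂ / C₁ * n) ^ K₀`. -/
theorem posteriorNotEquiv_le {K₀ : ℕ} {W : Fin K₀ → Finset (Fin n)} (hW : IsPartition W)
    {δ C₁ C₂ ε w : ℝ} (hn : 1 ≤ n) (hδ : 0 < δ) (hC₁ : 0 < C₁) (hC₂ : 1 ≤ C₂) (hε : 0 ≤ ε)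
    (hw : 0 < w) (hr₁ : ∀ i, C₁ * δ ≤ M.r (y i)) (hr₂ : ∀ i, M.r (y i) ≤ C₂ * δ)
    (hcross : ∀ i j, (¬ ∃ l, i ∈ W l ∧ j ∈ W l) → M.f (y i) (y j) ≤ ε)
    (hwithin : ∀ i j, i ≠ j → (∃ l, i ∈ W l ∧ j ∈ W l) → w ≤ M.f (y i) (y j)) :
    posteriorNotEquiv M y W ≤ (C₂ / C₁ * n) ^ K₀ *
      (((1 + C₂ * n * (δ * M.lam / w)) ^ Fintype.card (Sym2 (Fin n)) *
        (1 + ε / (δ * M.lam)) ^ Fintype.card (Sym2 (Fin n)) - 1) * (n + 1)) := by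
  classical
  have hlam := M.lam_pos
  have hC₂0 : 0 < C₂ := one_pos.trans_le hC₂
  have hKn : K₀ ≤ n := by
    have h : Function.Injective fun k => (hW.1 k).choose := fun k l hkl =>
      hW.eq_of_mem (hW.1 k).choose_spec (by
        have h : (hW.1 k).choose = (hW.1 l).choose := hkl
        rw [h]; exact (hW.1 l).choose_spec)
    simpa using Fintype.card_le_of_injective _ h
  have hden : integratedWeight M y W ≤ ∑ Q : LabelledPartition n, integratedWeight M y Q.2.1 :=
    Finset.single_le_sum (f := fun Q : LabelledPartition n => integratedWeight M y Q.2.1)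
      (fun Q _ => integratedWeight_nonneg M y Q.2.1)
      (Finset.mem_univ (⟨⟨K₀, by omega⟩, W, hW⟩ : LabelledPartition n))
  have hden' := (le_integratedWeight M y hW hδ hC₁ hr₁).trans hden
  have hnum := sum_integratedWeight_le M y hW hn hδ hC₂ hε hw hr₂ hcross hwithin
  have hB : 0 ≤ ((1 + C₂ * n * (δ * M.lam / w)) ^ Fintype.card (Sym2 (Fin n)) *
        (1 + ε / (δ * M.lam)) ^ Fintype.card (Sym2 (Fin n)) - 1) * ((n : ℝ) + 1) := by
    refine mul_nonneg (sub_nonneg.2 (one_le_mul_of_one_le_of_one_le (one_le_pow₀ ?_)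
      (one_le_pow₀ ?_))) (by positivity)
    · exact le_add_of_nonneg_right (by positivity)
    · exact le_add_of_nonneg_right (by positivity)
  have hpost : posteriorNotEquiv M y W =
      (∑ P : LabelledPartition n with ¬ PartEquiv P.2.1 W, integratedWeight M y P.2.1) /
        ∑ Q : LabelledPartition n, integratedWeight M y Q.2.1 := by
    rw [Finset.sum_div]
    rfl
  rw [hpost]
  refine div_le_of_le_mul₀ (Finset.sum_nonneg fun Q _ => integratedWeight_nonneg M y Q.2.1)
    (mul_nonneg (by positivity) hB) (hnum.trans ?_)
  refine le_trans (le_of_eq ?_) (mul_le_mul_of_nonneg_left hden' (mul_nonneg (by positivity) hB))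
  generalize ((1 + C₂ * n * (δ * M.lam / w)) ^ Fintype.card (Sym2 (Fin n)) *
        (1 + ε / (δ * M.lam)) ^ Fintype.card (Sym2 (Fin n)) - 1) * ((n : ℝ) + 1) = B
  have : (C₂ * n * (δ * M.lam)) ^ K₀ = (C₂ / C₁ * n) ^ K₀ * (C₁ * (δ * M.lam)) ^ K₀ := by
    rw [← mul_pow]
    congr 1
    field_simp
  rw [this]
  ring

end Bound

/-! ### Elementary limits and inequalities. -/

section Asymptotic

/-- Eventually `K n ≤ √n` and `log (A n) ≤ c √n`, so the logarithm of the left side is at most `c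
n`. -/
theorem eventually_mul_pow_le_exp_pow {K : ℕ → ℕ}
    (hK : (fun n => (K n : ℝ)) =o[atTop] fun n => Real.sqrt (n : ℝ)) {A c : ℝ} (hA : 0 < A)
    (hc : 0 < c) : ∀ᶠ n : ℕ in atTop, (A * n) ^ K n ≤ Real.exp c ^ n := by
  have h1 : ∀ᶠ n : ℕ in atTop, (K n : ℝ) ≤ Real.sqrt n := by
    filter_upwards [hK.bound one_pos] with n hn
    simpa [abs_of_nonneg (Real.sqrt_nonneg _)] using hn
  have h2 : ∀ᶠ n : ℕ in atTop, Real.log n ≤ c / 2 * Real.sqrt n := by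
    have := (isLittleO_log_rpow_atTop (r := 1 / 2) (by norm_num)).comp_tendsto
      (tendsto_natCast_atTop_atTop (R := ℝ))
    filter_upwards [this.bound (half_pos hc)] with n hn
    simp only [Function.comp, Real.norm_eq_abs, ← Real.sqrt_eq_rpow,
      abs_of_nonneg (Real.sqrt_nonneg _)] at hn
    exact (le_abs_self _).trans hn
  have hsqrt : Tendsto (fun n : ℕ => c / 2 * Real.sqrt n) atTop atTop :=
    (Real.tendsto_sqrt_atTop.comp tendsto_natCast_atTop_atTop).const_mul_atTop (half_pos hc)
  have h4 : Tendsto (fun n : ℕ => A * (n : ℝ)) atTop atTop :=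
    tendsto_natCast_atTop_atTop.const_mul_atTop hA
  filter_upwards [h1, h2, hsqrt.eventually_ge_atTop (Real.log A), h4.eventually_ge_atTop 1,
    eventually_gt_atTop 0] with n h1 h2 h3 h4 h5
  have hn : (0 : ℝ) < n := by exact_mod_cast h5
  have hlog : Real.log (A * n) ≤ c * Real.sqrt n := by
    rw [Real.log_mul hA.ne' hn.ne']
    linarith
  calc (A * n) ^ K n = Real.exp (K n * Real.log (A * n)) := by
        rw [Real.exp_nat_mul, Real.exp_log (by linarith)]
    _ ≤ Real.exp (n * c) := by
        refine Real.exp_le_exp.2 ?_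
        calc (K n : ℝ) * Real.log (A * n) ≤ Real.sqrt n * (c * Real.sqrt n) :=
              mul_le_mul h1 hlog (Real.log_nonneg h4) (Real.sqrt_nonneg _)
          _ = n * c := by
              rw [mul_left_comm, Real.mul_self_sqrt hn.le, mul_comm]
    _ = Real.exp c ^ n := Real.exp_nat_mul _ _

theorem tendsto_mul_pow_mul_pow_mul_pow {K : ℕ → ℕ}
    (hK : (fun n => (K n : ℝ)) =o[atTop] fun n => Real.sqrt (n : ℝ)) {A ρ : ℝ} (hA : 0 < A)
    (hρ₀ : 0 < ρ) (hρ : ρ < 1) (k : ℕ) :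
    Tendsto (fun n : ℕ => (A * n) ^ K n * ((n : ℝ) ^ k * ρ ^ n)) atTop (𝓝 0) := by
  have hlog := Real.log_neg hρ₀ hρ
  -- With `c = -log ρ / 2` the growth `exp c ^ n` uses up only half of the decay: `exp c * ρ = √ρ`.
  have hlt : Real.exp (-Real.log ρ / 2) * ρ < 1 := by
    conv_lhs => rw [← Real.exp_log hρ₀, Real.log_exp, ← Real.exp_add]
    exact Real.exp_lt_one_iff.2 (by linarith)
  have hlim := tendsto_pow_const_mul_const_pow_of_lt_one k
    (mul_pos (Real.exp_pos (-Real.log ρ / 2)) hρ₀).le hlt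
  refine squeeze_zero' (Eventually.of_forall fun n => by positivity) ?_ hlim
  filter_upwards [eventually_mul_pow_le_exp_pow hK hA
    (show 0 < -Real.log ρ / 2 by linarith)] with n hn
  calc (A * n) ^ K n * ((n : ℝ) ^ k * ρ ^ n)
      ≤ Real.exp (-Real.log ρ / 2) ^ n * ((n : ℝ) ^ k * ρ ^ n) :=
        mul_le_mul_of_nonneg_right hn (by positivity)
    _ = (n : ℝ) ^ k * (Real.exp (-Real.log ρ / 2) * ρ) ^ n := by rw [mul_pow]; ring

/-- From `1 + x ≤ exp x` and `|exp x - 1| ≤ 2 |x|` for `|x| ≤ 1`. -/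
theorem one_add_pow_mul_one_add_pow_sub_one_le {a b : ℝ} (ha : 0 ≤ a) (hb : 0 ≤ b) (N : ℕ)
    (h : N * (a + b) ≤ 1) : (1 + a) ^ N * (1 + b) ^ N - 1 ≤ 2 * (N * (a + b)) := by
  have h1 : (1 + a) ^ N * (1 + b) ^ N ≤ Real.exp (N * (a + b)) := by
    rw [← mul_pow, Real.exp_nat_mul]
    refine pow_le_pow_left₀ (by positivity) ?_ _
    rw [Real.exp_add]
    refine mul_le_mul ?_ ?_ (by positivity) (Real.exp_pos _).le
    · linarith [Real.add_one_le_exp a]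
    · linarith [Real.add_one_le_exp b]
  have h0 : 0 ≤ N * (a + b) := by positivity
  have h2 := Real.abs_exp_sub_one_le (x := N * (a + b)) (by rwa [abs_of_nonneg h0])
  rw [abs_of_nonneg h0] at h2
  linarith [le_abs_self (Real.exp (N * (a + b)) - 1)]

theorem card_sym2_fin_le (n : ℕ) : (Fintype.card (Sym2 (Fin n)) : ℝ) ≤ (n : ℝ) ^ 2 := by
  have : Fintype.card (Sym2 (Fin n)) ≤ Fintype.card (Fin n × Fin n) :=
    Fintype.card_le_of_surjective (fun p => s(p.1, p.2)) fun e => by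
      induction e with
      | h i j => exact ⟨(i, j), rfl⟩
  rw [Fintype.card_prod, Fintype.card_fin] at this
  rw [sq]
  exact_mod_cast this

end Asymptotic

/-! ### The fixed-size bound for the oracle partition. -/

section Oracle

theorem isPartition_oraclePartition (z : ℕ → ℕ) (n : ℕ) : IsPartition (oraclePartition z n) := by
  refine ⟨?_, ?_, ?_⟩
  · rintro ⟨k, hk⟩
    obtain ⟨i, hi, rfl⟩ := Finset.mem_image.1 hk
    exact ⟨⟨i, Finset.mem_range.1 hi⟩, by simp [oraclePartition]⟩
  · intro k l hkl
    refine Finset.disjoint_left.2 fun i hk hl => hkl (Subtype.ext ?_)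
    simp only [oraclePartition, Finset.mem_filter, Finset.mem_univ, true_and] at hk hl
    rw [← hk, ← hl]
  · intro i
    exact ⟨⟨z i, Finset.mem_image_of_mem _ (Finset.mem_range.2 i.2)⟩, by simp [oraclePartition]⟩

theorem exists_mem_oraclePartition_iff (z : ℕ → ℕ) (n : ℕ) (i j : Fin n) :
    (∃ l, i ∈ oraclePartition z n l ∧ j ∈ oraclePartition z n l) ↔ z i = z j := by
  constructor
  · rintro ⟨l, hi, hj⟩
    simp only [oraclePartition, Finset.mem_filter, Finset.mem_univ, true_and] at hi hj
    rw [hi, hj]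
  · intro h
    refine ⟨⟨z i, Finset.mem_image_of_mem _ (Finset.mem_range.2 i.2)⟩, ?_⟩
    simp [oraclePartition, h]

theorem one_le_K0 (z : ℕ → ℕ) {n : ℕ} (hn : 1 ≤ n) : 1 ≤ K0 z n :=
  Finset.card_pos.2 ⟨z 0, Finset.mem_image_of_mem _ (Finset.mem_range.2 hn)⟩

variable {Y : ℕ → Type*} (M : ∀ n, Model (Y n)) (z : ℕ → ℕ) (y : ∀ n, Fin n → Y n) (n : ℕ)

theorem crossSup_nonneg : 0 ≤ crossSup M z y n := by
  refine Real.sSup_nonneg ?_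
  rintro x ⟨s, t, -, rfl⟩
  exact (M n).f_nonneg _ _

theorem le_crossSup {s t : Fin n} (h : z s ≠ z t) : (M n).f (y n s) (y n t) ≤ crossSup M z y n := by
  refine le_csSup (Set.Finite.bddAbove ?_) ⟨s, t, h, rfl⟩
  refine (Set.finite_range fun p : Fin n × Fin n => (M n).f (y n p.1) (y n p.2)).subset ?_
  rintro x ⟨s, t, -, rfl⟩
  exact ⟨(s, t), rfl⟩

theorem withinInf_le {s t : Fin n} (hst : s ≠ t) (h : z s = z t) :
    withinInf M z y n ≤ (M n).f (y n s) (y n t) := by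
  refine csInf_le ⟨0, ?_⟩ ⟨s, t, hst, h, rfl⟩
  rintro x ⟨s, t, -, -, rfl⟩
  exact (M n).f_nonneg _ _

theorem crossSup_eq_zero (h : K0 z n = 1) : crossSup M z y n = 0 := by
  have : {x : ℝ | ∃ s t : Fin n, z s ≠ z t ∧ x = (M n).f (y n s) (y n t)} = ∅ := by
    refine Set.eq_empty_of_forall_notMem ?_
    rintro x ⟨s, t, hst, -⟩
    have hmem : ∀ i : Fin n, z i ∈ oracleLabels z n := fun i =>
      Finset.mem_image_of_mem _ (Finset.mem_range.2 i.2)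
    exact hst (Finset.card_le_one.1 (le_of_eq h) _ (hmem s) _ (hmem t))
  rw [crossSup, this, Real.sSup_empty]

theorem posteriorNotEquiv_oraclePartition_le {δ C₁ C₂ : ℝ} (hn : 1 ≤ n) (hδ : 0 < δ) (hC₁ : 0 < C₁)
    (hC₂ : 1 ≤ C₂) (hw : 0 < withinInf M z y n)
    (hr : ∀ i, C₁ * δ ≤ (M n).r (y n i) ∧ (M n).r (y n i) ≤ C₂ * δ) :
    posteriorNotEquiv (M n) (y n) (oraclePartition z n) ≤ (C₂ / C₁ * n) ^ K0 z n *
      (((1 + C₂ * n * (δ * (M n).lam / withinInf M z y n)) ^ Fintype.card (Sym2 (Fin n)) *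
        (1 + crossSup M z y n / (δ * (M n).lam)) ^ Fintype.card (Sym2 (Fin n)) - 1) *
          (n + 1)) := by
  let e : Fin (K0 z n) ≃ {k // k ∈ oracleLabels z n} := (oracleLabels z n).equivFin.symm
  have hP := isPartition_oraclePartition z n
  have hmem : ∀ i j, (∃ l, i ∈ (oraclePartition z n ∘ e) l ∧ j ∈ (oraclePartition z n ∘ e) l) ↔
      z i = z j := by
    intro i j
    rw [← exists_mem_oraclePartition_iff z n i j]
    exact e.exists_congr_left.trans (by simp)
  rw [← posteriorNotEquiv_comp_equiv (M n) (y n) _ e]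
  refine posteriorNotEquiv_le (M n) (y n) (W := oraclePartition z n ∘ e) ?_ hn hδ hC₁ hC₂
    (crossSup_nonneg M z y n) hw (fun i => (hr i).1) (fun i => (hr i).2) ?_ ?_
  · refine ⟨fun k => hP.1 _, fun k l hkl => hP.2.1 _ _ (e.injective.ne hkl), fun i => ?_⟩
    obtain ⟨k, hk⟩ := hP.2.2 i
    exact ⟨e.symm k, by simpa using hk⟩
  · intro i j h
    exact le_crossSup M z y n (mt (hmem i j).2 h)
  · intro i j hij h
    exact withinInf_le M z y n hij ((hmem i j).1 h)

end Oracle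

/-! ### Geometric decay on the nice set. -/

section NiceSet

variable {Y : ℕ → Type*} {M : ∀ n, Model (Y n)} {z : ℕ → ℕ} {δ : ℕ → ℝ} {y : ∀ n, Fin n → Y n}

/-- The bases in the nice set are at least `1 + ι₁` (when there are two or more clusters) and `1 +
ι₂`; only this common geometric rate is kept. -/
theorem exists_geometric_bound_of_mem_niceSet (hy : y ∈ niceSet M z δ) :
    ∃ ρ B : ℝ, 0 < ρ ∧ ρ < 1 ∧ 0 < B ∧ ∀ᶠ n in atTop,
      crossSup M z y n / (δ n * (M n).lam) ≤ B * ρ ^ n ∧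
      δ n * (M n).lam / withinInf M z y n ≤ B * ρ ^ n := by
  obtain ⟨⟨ι₁, hι₁, B₁, hB₁, h₁⟩, ι₂, hι₂, -, B₂, hB₂, h₂⟩ := hy
  have hρ₁ : (1 + ι₁)⁻¹ < 1 := inv_lt_one_of_one_lt₀ (by linarith)
  have hρ₂ : (1 + ι₂)⁻¹ < 1 := inv_lt_one_of_one_lt₀ (by linarith)
  have hp₁ : 0 < (1 + ι₁)⁻¹ := by positivity
  have hp₂ : 0 < (1 + ι₂)⁻¹ := by positivity
  have key : ∀ (B ι b : ℝ) (n : ℕ), 0 ≤ B → 0 < ι → 1 + ι ≤ b → B ≤ max B₁ B₂ →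
      (1 + ι)⁻¹ ≤ max (1 + ι₁)⁻¹ (1 + ι₂)⁻¹ →
      B * (b ^ n)⁻¹ ≤ max B₁ B₂ * max (1 + ι₁)⁻¹ (1 + ι₂)⁻¹ ^ n := by
    intro B ι b n hB hι hb hBm hιm
    have hb' : b⁻¹ ≤ max (1 + ι₁)⁻¹ (1 + ι₂)⁻¹ :=
      (inv_anti₀ (by positivity) hb).trans hιm
    have hb0 : 0 < b := by linarith
    rw [← inv_pow]
    exact mul_le_mul hBm (pow_le_pow_left₀ (by positivity) hb' n) (by positivity) (hB.trans hBm)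
  refine ⟨max (1 + ι₁)⁻¹ (1 + ι₂)⁻¹, max B₁ B₂, lt_max_of_lt_left hp₁, max_lt hρ₁ hρ₂,
    lt_max_of_lt_left hB₁, ?_⟩
  filter_upwards [h₁, h₂, eventually_ge_atTop 1] with n h₁ h₂ hn
  have hK := one_le_K0 z hn
  constructor
  -- For a single cluster the first base is `ι₁`, possibly below `1`, so the assumed rate is
  -- useless; but then `crossSup` vanishes.
  · rcases hK.eq_or_lt with hK | hK
    · rw [crossSup_eq_zero M z y n hK.symm, zero_div]
      have := lt_max_of_lt_left (c := (1 + ι₂)⁻¹) hp₁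
      have := lt_max_of_lt_left (c := B₂) hB₁
      positivity
    · have hK' : (2 : ℝ) ≤ K0 z n := by exact_mod_cast hK
      exact h₁.trans (key B₁ ι₁ _ n hB₁.le hι₁ (by linarith) (le_max_left _ _) (le_max_left _ _))
  · have hK' : (0 : ℝ) ≤ K0 z n := Nat.cast_nonneg _
    exact h₂.trans (key B₂ ι₂ _ n hB₂.le hι₂ (by linarith) (le_max_right _ _) (le_max_right _ _))

end NiceSet

end BSF

/-! ### Conclusion. -/

theorem mainTheorem2 {Y : ℕ → Type*} (M : ∀ n, BSF.Model (Y n)) (z : ℕ → ℕ)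
    (δ : ℕ → ℝ) (hδ : ∀ n, 0 < δ n) (hK : BSF.OracleGrowth z) :
    {y : ∀ n, Fin n → Y n | BSF.RootAssumption M δ y} ∩ BSF.niceSet M z δ ⊆
      {y | (fun n => BSF.posteriorNotEquiv (M n) (y n) (BSF.oraclePartition z n))
        =o[atTop] (fun _ => (1 : ℝ))} := by
  rintro y ⟨⟨C₁, C₂, hC₁, -, hr⟩, hy⟩
  obtain ⟨ρ, B, hρ₀, hρ, hB, hgeo⟩ := BSF.exists_geometric_bound_of_mem_niceSet hy
  obtain ⟨-, -, -, hw, -⟩ := hy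
  set C := max C₂ 1 with hC
  have hC1 : 1 ≤ C := le_max_right _ _
  have hC0 : 0 < C := one_pos.trans_le hC1
  -- The power `n ^ 4` collects `n ^ 2` possible edges, the `n` in `C * n`, and `n + 1 ≤ 2 n`. The
  -- `8` is one `2` from adding the two ratios, one from linearizing the exponential, and one from
  -- `n + 1 ≤ 2 n`.
  have hlim := (BSF.tendsto_mul_pow_mul_pow_mul_pow hK (div_pos hC0 hC₁) hρ₀ hρ 4).const_mul
    (8 * (C * B))
  rw [mul_zero] at hlim
  -- This puts the exponent eventually below `1`, as the linearization requires.
  have hsmall := (tendsto_pow_const_mul_const_pow_of_lt_one 3 hρ₀.le hρ).const_mul (2 * (C * B))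
  rw [mul_zero] at hsmall
  refine (isLittleO_one_iff ℝ).2 (squeeze_zero'
    (Eventually.of_forall fun n => BSF.posteriorNotEquiv_nonneg _ _ _) ?_ hlim)
  filter_upwards [hr, hgeo, hw, hsmall.eventually_le_const one_pos, eventually_ge_atTop 1]
    with n hr ⟨hcross, hwithin⟩ hw hsmall hn
  have hn1 : (1 : ℝ) ≤ n := by exact_mod_cast hn
  have hβ : 0 < δ n * (M n).lam := mul_pos (hδ n) (M n).lam_pos
  have hbound := BSF.posteriorNotEquiv_oraclePartition_le M z y n hn (hδ n) hC₁ hC1 hw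
    fun i => ⟨(hr i).1, (hr i).2.trans
      (mul_le_mul_of_nonneg_right (le_max_left _ _) (hδ n).le)⟩
  have hε := BSF.crossSup_nonneg M z y n
  have hN := BSF.card_sym2_fin_le n
  have hCn : 1 ≤ C * n := one_le_mul_of_one_le_of_one_le hC1 hn1
  have hexp : (Fintype.card (Sym2 (Fin n)) : ℝ) * (C * n * (δ n * (M n).lam /
      BSF.withinInf M z y n) + BSF.crossSup M z y n / (δ n * (M n).lam)) ≤
      2 * (C * B) * ((n : ℝ) ^ 3 * ρ ^ n) := by
    have hsum : C * n * (δ n * (M n).lam / BSF.withinInf M z y n) +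
        BSF.crossSup M z y n / (δ n * (M n).lam) ≤ 2 * (C * n * (B * ρ ^ n)) := by
      have h1 := mul_le_mul_of_nonneg_left hwithin (zero_le_one.trans hCn)
      have h2 := le_mul_of_one_le_left (by positivity : 0 ≤ B * ρ ^ n) hCn
      linarith
    calc _ ≤ (n : ℝ) ^ 2 * (2 * (C * n * (B * ρ ^ n))) :=
          mul_le_mul hN hsum (by positivity) (by positivity)
      _ = _ := by ring
  have hpow := BSF.one_add_pow_mul_one_add_pow_sub_one_le (by positivity) (by positivity) _
    (hexp.trans hsmall)
  refine hbound.trans ?_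
  calc _ ≤ (C / C₁ * n) ^ BSF.K0 z n *
        (2 * (2 * (C * B) * ((n : ℝ) ^ 3 * ρ ^ n)) * (2 * n)) := by
        refine mul_le_mul_of_nonneg_left ?_ (by positivity)
        refine mul_le_mul (hpow.trans (by linarith)) (by linarith) (by positivity) (by positivity)
    _ = _ := by ring
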